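/- Let $n\ge 1$, let $J$ be one of the intervals $\mathbb{R}$, $(-\infty,0]$, $[0,+\infty)$, and let $A\colon J\to M_n(\mathbb{R})$ be locally integrable (for instance continuous). A fundamental matrix of $\dot x=A(t)x$ on $J$ is a matrix function $X(t)$ whose columns are solutions on $J$ and are linearly independent at every $t\in J$ (solutions of a system with locally integrable coefficients are locally absolutely continuous and satisfy the equation almost everywhere). The system has an exponential dichotomy on $J$ with projection $P=P^2$ if there are a fundamental matrix $X$ and constants $K,\alpha>0$ with $\|X(t)PX^{-1}(s)\|\le Ke^{-\alpha(t-s)}$ for $t\ge s$ in $J$ and $\|X(t)(I-P)X^{-1}(s)\|\le Ke^{-\alpha(s-t)}$ for $t\le s$ in $J$. The exponential dichotomy spectrum $\Sigma_J(A)$ is the set of all $\lambda\in\mathbb{R}$ for which $\dot x=[A(t)-\lambda I]x$ has no exponential dichotomy on $J$. The resolvent is $\rho_J(A)=\mathbb{R}\setminus\Sigma_J(A)$, and the connected components of $\rho_J(A)$ are called the spectral gaps. Assume that $\dot x=A(t)x$ has bounded growth and decay on $J$: for some fundamental matrix $X$ and constants $K>0$, $\alpha\ge 0$, one has $\|X(t)X^{-1}(s)\|\le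 Ke^{\alpha|t-s|}$ for all $t,s\in J$. Then: (1) There are an integer $\ell$ with $1\le\ell\le n$ and real numbers $a_1\le b_1<a_2\le b_2<\dots<a_\ell\le b_\ell$ such that $\Sigma_J(A)=[a_1,b_1]\cup[a_2,b_2]\cup\dots\cup[a_\ell,b_\ell]$. (2) The resolvent $\rho_J(A)$ is a union of at most $n+1$ nonempty, pairwise disjoint open intervals. (3) If $\lambda,\mu\in\rho_J(A)$ and the systems $\dot x=[A(t)-\lambda I]x$ and $\dot x=[A(t)-\mu I]x$ have exponential dichotomies on $J$ with projections $P_\lambda$ and $P_\mu$, then $\operatorname{rank}P_\lambda\le\operatorname{rank}P_\mu$ whenever $\lambda\le\mu$, and $\operatorname{rank}P_\lambda=\operatorname{rank}P_\mu$ if and only if $\lambda$ and $\mu$ lie in the same spectral gap. In particular the rank depends only on $\lambda$, is nondecreasing in $\lambda$, and is constant on each spectral gap. -/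

import Mathlib

open Set MeasureTheory
open scoped Matrix Matrix.Norms.L2Operator

namespace DichotomySpectrum

variable {n : ℕ}

/-- `x` is a (Carathéodory) solution of `ẋ = A(t) x` on the interval `J`: it is continuous on `J` and
satisfies the integrated equation there. For locally integrable `A` this means that `x` is locally
absolutely continuous and satisfies the equation almost everywhere; for continuous `A` it means
that `x` is differentiable and satisfies the equation everywhere on `J`. -/
def IsSolutionOn (A : ℝ → Matrix (Fin n) (Fin n) ℝ) (J : Set ℝ) (x : ℝ → Fin n → ℝ) : Prop :=
  ContinuousOn x J ∧ ∀ s ∈ J, ∀ t ∈ J, x t = x s + ∫ u in s..t, A u *ᵥ x u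

/-- `X` is a fundamental matrix of `ẋ = A(t) x` on `J`: its columns are solutions and are linearly
independent at every time of `J`. -/
structure IsFundamentalMatrix (A : ℝ → Matrix (Fin n) (Fin n) ℝ) (J : Set ℝ)
    (X : ℝ → Matrix (Fin n) (Fin n) ℝ) : Prop where
  isSolutionOn_col : ∀ j, IsSolutionOn A J (fun t => (X t).col j)
  linearIndependent_col : ∀ t ∈ J, LinearIndependent ℝ (X t).col

/-- The transition matrix `X(t, s) = X(t) X(s)⁻¹`. -/
noncomputable def transitionMatrix (X : ℝ → Matrix (Fin n) (Fin n) ℝ) (t s : ℝ) :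
    Matrix (Fin n) (Fin n) ℝ :=
  X t * (X s)⁻¹

/-- Bounded growth and decay of `ẋ = A(t) x` on `J`: `‖X(t, s)‖ ≤ K exp (α |t - s|)` on `J`.
Matrices carry the operator norm of the Euclidean norm; the notion does not depend on this choice,
since all norms on a space of matrices are equivalent. -/
def HasBoundedGrowthDecay (A : ℝ → Matrix (Fin n) (Fin n) ℝ) (J : Set ℝ) : Prop :=
  ∃ X, IsFundamentalMatrix A J X ∧ ∃ K α : ℝ, 0 < K ∧ 0 ≤ α ∧
    ∀ t ∈ J, ∀ s ∈ J, ‖transitionMatrix X t s‖ ≤ K * Real.exp (α * |t - s|)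

/-- `ẋ = A(t) x` has an exponential dichotomy on `J` with projection `P` (relative to some
fundamental matrix `X`; another fundamental matrix has the form `X(t) V` and changes `P` into the
similar projection `V⁻¹ P V`). -/
def HasExpDichotomyWith (A : ℝ → Matrix (Fin n) (Fin n) ℝ) (J : Set ℝ)
    (P : Matrix (Fin n) (Fin n) ℝ) : Prop :=
  P * P = P ∧ ∃ X, IsFundamentalMatrix A J X ∧ ∃ K α : ℝ, 0 < K ∧ 0 < α ∧
    (∀ t ∈ J, ∀ s ∈ J, s ≤ t → ‖X t * P * (X s)⁻¹‖ ≤ K * Real.exp (-α * (t - s))) ∧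
    (∀ t ∈ J, ∀ s ∈ J, t ≤ s → ‖X t * (1 - P) * (X s)⁻¹‖ ≤ K * Real.exp (-α * (s - t)))

/-- The coefficient `A(t) - μ I` of the shifted system. -/
def shift (A : ℝ → Matrix (Fin n) (Fin n) ℝ) (μ : ℝ) : ℝ → Matrix (Fin n) (Fin n) ℝ :=
  fun t => A t - μ • (1 : Matrix (Fin n) (Fin n) ℝ)

/-- The exponential dichotomy spectrum on `J`: all `μ` for which `ẋ = [A(t) - μ I] x` has no
exponential dichotomy on `J`. -/
def dichotomySpectrum (A : ℝ → Matrix (Fin n) (Fin n) ℝ) (J : Set ℝ) : Set ℝ :=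
  {μ | ¬ ∃ P, HasExpDichotomyWith (shift A μ) J P}

/-- The resolvent on `J`. -/
def dichotomyResolvent (A : ℝ → Matrix (Fin n) (Fin n) ℝ) (J : Set ℝ) : Set ℝ :=
  (dichotomySpectrum A J)ᶜ

/-- The spectral gap of a point `μ` of the resolvent: its connected component in the resolvent,
that is, the largest interval containing `μ` and contained in the resolvent. -/
def spectralGap (A : ℝ → Matrix (Fin n) (Fin n) ℝ) (J : Set ℝ) (μ : ℝ) : Set ℝ :=
  connectedComponentIn (dichotomyResolvent A J) μ

end DichotomySpectrum

/-!
Fix the fundamental matrix `X` of `ẋ = A(t) x` that bounded growth provides. Since solutions are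
unique (`IsSolutionOn.eqOn`), every fundamental matrix of the shifted system has the form
`exp (-λ t) X(t) V` with `V` constant. A dichotomy of the shifted system is therefore a splitting of
the transition matrices of this one `X` along a projection, with rates strictly below and above `λ`
(`SplitsAt`), and the passage preserves the rank of the projection.

Let `P` and `Q` be projections of splittings at `λ ≤ μ`. If `J` reaches `+∞`, then `(1 - Q) P` is a
product of a factor with backward decay `exp (-(μ + β) t)` and one with forward growth
`exp ((λ - α) t)`, so it vanishes and the range of `P` lies in that of `Q`; if `J` reaches `-∞`, the
same argument gives `P (1 - Q) = 0`, an inclusion of kernels. In both cases `rank P ≤ rank Q`. If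
the ranks agree, the ranges (or the kernels) coincide, and one of the two projections splits the
system at every point of `[λ, μ]`. A splitting also persists under small changes of `λ`.

Hence the points of the resolvent with a projection of rank `k` form open intervals `G k`, placed
from left to right for `k = 0, …, n`. Bounded growth and decay puts all very negative `λ` into `G 0`
(with `P = 0`) and all large `λ` into `G n` (with `P = 1`). What remains is order topology: the
spectral gaps are the nonempty `G k`, and the spectrum consists of the compact intervals between
neighbouring gaps (`compl_iUnion_eq_iUnion_Icc`).
-/

namespace DichotomySpectrum

/-! ### Carathéodory solutions -/

section Solutions

variable {n : ℕ} {A : ℝ → Matrix (Fin n) (Fin n) ℝ} {J : Set ℝ}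

lemma integrableOn_entry (hA : LocallyIntegrableOn A J) {k : Set ℝ} (hk : k ⊆ J)
    (hc : IsCompact k) (i j : Fin n) : IntegrableOn (fun u => A u i j) k := by
  have h := hA.integrableOn_compact_subset hk hc
  exact (LinearMap.toContinuousLinearMap
    (Matrix.entryLinearMap ℝ ℝ i j : Matrix (Fin n) (Fin n) ℝ →ₗ[ℝ] ℝ)).integrable_comp h

lemma intervalIntegrable_mulVec_apply (hJ : J.OrdConnected) (hA : LocallyIntegrableOn A J)
    {x : ℝ → Fin n → ℝ} (hx : ContinuousOn x J) {s t : ℝ} (hs : s ∈ J) (ht : t ∈ J) (i : Fin n) :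
    IntervalIntegrable (fun u => (A u *ᵥ x u) i) volume s t := by
  have hsub : uIcc s t ⊆ J := hJ.uIcc_subset hs ht
  have h : ∀ j ∈ Finset.univ, IntervalIntegrable (fun u => A u i j * x u j) volume s t := by
    intro j _
    refine IntervalIntegrable.mul_continuousOn ?_ ?_
    · exact (integrableOn_entry hA hsub isCompact_uIcc i j).intervalIntegrable
    · exact (continuousOn_pi.1 hx j).mono hsub
  have hsum : (fun u => (A u *ᵥ x u) i) = ∑ j, fun u => A u i j * x u j := by
    funext u
    simp [Matrix.mulVec, dotProduct]
  exact hsum ▸ IntervalIntegrable.sum Finset.univ h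

lemma intervalIntegrable_mulVec (hJ : J.OrdConnected) (hA : LocallyIntegrableOn A J)
    {x : ℝ → Fin n → ℝ} (hx : ContinuousOn x J) {s t : ℝ} (hs : s ∈ J) (ht : t ∈ J) :
    IntervalIntegrable (fun u => A u *ᵥ x u) volume s t := by
  have h := fun i => intervalIntegrable_iff.1 (intervalIntegrable_mulVec_apply hJ hA hx hs ht i)
  exact intervalIntegrable_iff.2 (Integrable.of_eval h)

/-- The integrated equation, read coordinate by coordinate. -/
lemma isSolutionOn_iff (hJ : J.OrdConnected) (hA : LocallyIntegrableOn A J)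
    {x : ℝ → Fin n → ℝ} :
    IsSolutionOn A J x ↔ ContinuousOn x J ∧ ∀ s ∈ J, ∀ t ∈ J, ∀ i,
      x t i = x s i + ∫ u in s..t, (A u *ᵥ x u) i := by
  refine and_congr_right fun hx => ?_
  refine forall₂_congr fun s hs => forall₂_congr fun t ht => ?_
  rw [funext_iff]
  refine forall_congr' fun i => ?_
  have := (ContinuousLinearMap.proj (R := ℝ) (φ := fun _ : Fin n => ℝ) i).intervalIntegral_comp_comm
    (intervalIntegrable_mulVec hJ hA hx hs ht)
  simp only [ContinuousLinearMap.proj_apply] at this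
  rw [Pi.add_apply, this]

lemma IsSolutionOn.zero : IsSolutionOn A J (fun _ => 0) :=
  ⟨continuousOn_const, fun s _ t _ => by simp⟩

lemma IsSolutionOn.add (hJ : J.OrdConnected) (hA : LocallyIntegrableOn A J)
    {x y : ℝ → Fin n → ℝ} (hx : IsSolutionOn A J x) (hy : IsSolutionOn A J y) :
    IsSolutionOn A J (fun t => x t + y t) := by
  refine ⟨hx.1.add hy.1, fun s hs t ht => ?_⟩
  simp only [Matrix.mulVec_add]
  rw [intervalIntegral.integral_add (intervalIntegrable_mulVec hJ hA hx.1 hs ht)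
    (intervalIntegrable_mulVec hJ hA hy.1 hs ht), hx.2 s hs t ht, hy.2 s hs t ht]
  abel

lemma IsSolutionOn.smul {x : ℝ → Fin n → ℝ} (hx : IsSolutionOn A J x) (c : ℝ) :
    IsSolutionOn A J (fun t => c • x t) := by
  refine ⟨hx.1.const_smul c, fun s hs t ht => ?_⟩
  simp only [Matrix.mulVec_smul]
  rw [intervalIntegral.integral_smul, hx.2 s hs t ht, smul_add]

lemma IsSolutionOn.sum (hJ : J.OrdConnected) (hA : LocallyIntegrableOn A J) {ι : Type*}
    (σ : Finset ι) {x : ι → ℝ → Fin n → ℝ} (hx : ∀ k, IsSolutionOn A J (x k)) :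
    IsSolutionOn A J (fun t => ∑ k ∈ σ, x k t) := by
  classical
  induction σ using Finset.induction_on with
  | empty => simpa using IsSolutionOn.zero
  | insert k σ hk ih => simpa [Finset.sum_insert hk] using (hx k).add hJ hA ih

/-- A solution that vanishes at one time of `J` vanishes on `J`: its zero set is closed by
continuity, and it is open because, near a zero `t₀`, the integral of `∑ |A i j|` from `t₀` is less
than `1/2`, so that the integrated equation bounds the maximum of `‖x‖` by half of itself. -/
lemma IsSolutionOn.eq_zero (hJ : J.OrdConnected) (hJc : IsClosed J)
    (hA : LocallyIntegrableOn A J) {x : ℝ → Fin n → ℝ} (hx : IsSolutionOn A J x)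
    {s : ℝ} (hs : s ∈ J) (hxs : x s = 0) : ∀ t ∈ J, x t = 0 := by
  set g : ℝ → ℝ := fun u => ∑ i, ∑ j, |A u i j| with hg
  have hg0 : ∀ u, 0 ≤ g u := fun u => by positivity
  have hgb : ∀ u (v : Fin n → ℝ), ‖A u *ᵥ v‖ ≤ g u * ‖v‖ := by
    intro u v
    refine (pi_norm_le_iff_of_nonneg (mul_nonneg (hg0 u) (norm_nonneg v))).2 fun i => ?_
    calc ‖(A u *ᵥ v) i‖ ≤ ∑ j, ‖A u i j * v j‖ := by
          simpa only [Matrix.mulVec, dotProduct] using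
            norm_sum_le Finset.univ fun j => A u i j * v j
      _ ≤ ∑ j, |A u i j| * ‖v‖ := Finset.sum_le_sum fun j _ => by
          rw [norm_mul, Real.norm_eq_abs]
          exact mul_le_mul_of_nonneg_left (norm_le_pi_norm v j) (abs_nonneg _)
      _ = (∑ j, |A u i j|) * ‖v‖ := by rw [Finset.sum_mul]
      _ ≤ g u * ‖v‖ := by
          refine mul_le_mul_of_nonneg_right ?_ (norm_nonneg v)
          exact Finset.single_le_sum (f := fun i => ∑ j, |A u i j|)
            (fun i _ => Finset.sum_nonneg fun j _ => abs_nonneg _) (Finset.mem_univ i)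
  have hgi : ∀ k ⊆ J, IsCompact k → IntegrableOn g k := fun k hk hc =>
    integrable_finsetSum _ fun i _ => integrable_finsetSum _ fun j _ =>
      (integrableOn_entry hA hk hc i j).abs
  -- Extending `g` by zero outside `J` makes its primitive continuous on all of `ℝ`.
  have hBi : ∀ a b, IntervalIntegrable (J.indicator g) volume a b := by
    intro a b
    refine IntegrableOn.intervalIntegrable ?_
    rw [IntegrableOn, integrable_indicator_iff hJc.measurableSet, IntegrableOn,
      Measure.restrict_restrict hJc.measurableSet]
    exact hgi _ inter_subset_left (isCompact_uIcc.inter_left hJc)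
  have : PreconnectedSpace J := Subtype.preconnectedSpace hJ.isPreconnected
  have hcl : IsClopen {t : J | x t = 0} := by
    have hxc : Continuous fun t : J => x t := continuousOn_iff_continuous_domRestrict.1 hx.1
    refine ⟨isClosed_eq hxc continuous_const, isOpen_iff_mem_nhds.2 ?_⟩
    rintro ⟨t₀, ht₀⟩ (h0 : x t₀ = 0)
    have hψ : Continuous fun t => |∫ u in t₀..t, J.indicator g u| :=
      (intervalIntegral.continuous_primitive hBi t₀).abs
    have hev : ∀ᶠ t in nhds t₀, |∫ u in t₀..t, J.indicator g u| < 1 / 2 :=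
      hψ.continuousAt.eventually_lt continuousAt_const (by simp)
    obtain ⟨ε, hε, hball⟩ := Metric.eventually_nhds_iff_ball.1 hev
    refine Filter.mem_of_superset (Metric.ball_mem_nhds (⟨t₀, ht₀⟩ : J) hε) ?_
    rintro ⟨t, ht⟩ htb
    change x t = 0
    have hsub : uIcc t₀ t ⊆ J := hJ.uIcc_subset ht₀ ht
    have hsubb : uIcc t₀ t ⊆ Metric.ball t₀ ε := by
      refine OrdConnected.uIcc_subset ?_ (Metric.mem_ball_self hε) htb
      rw [Real.ball_eq_Ioo]; exact ordConnected_Ioo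
    obtain ⟨v, hv, hmax⟩ := isCompact_uIcc.exists_isMaxOn nonempty_uIcc
      (hx.1.mono hsub).norm
    have hvt : uIcc t₀ v ⊆ uIcc t₀ t := uIcc_subset_uIcc_left hv
    have hle : ‖x v‖ ≤ ‖x v‖ * (1 / 2) := by
      have h1 := hx.2 t₀ ht₀ v (hsub hv)
      rw [h0, zero_add] at h1
      calc ‖x v‖ = ‖∫ u in t₀..v, A u *ᵥ x u‖ := by rw [← h1]
        _ ≤ |∫ u in t₀..v, ‖x v‖ * J.indicator g u| := by
            refine intervalIntegral.norm_integral_le_abs_of_norm_le ?_ ((hBi _ _).const_mul _)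
            refine (ae_restrict_iff' measurableSet_uIoc).2 (Filter.Eventually.of_forall ?_)
            intro u hu
            have hu' := hvt (uIoc_subset_uIcc hu)
            rw [indicator_of_mem (hsub hu'), mul_comm]
            exact (hgb u _).trans (mul_le_mul_of_nonneg_left (hmax hu') (hg0 u))
        _ = ‖x v‖ * |∫ u in t₀..v, J.indicator g u| := by
            rw [intervalIntegral.integral_const_mul, abs_mul, abs_norm]
        _ ≤ ‖x v‖ * (1 / 2) :=
            mul_le_mul_of_nonneg_left (hball v (hsubb hv)).le (norm_nonneg _)
    have hv0 : ‖x v‖ ≤ 0 := by linarith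
    exact norm_le_zero_iff.1 ((hmax (right_mem_uIcc (a := t₀) (b := t))).trans hv0)
  have huniv := hcl.eq_univ ⟨⟨s, hs⟩, hxs⟩
  intro t ht
  exact (huniv ▸ mem_univ (⟨t, ht⟩ : J) : (⟨t, ht⟩ : J) ∈ {t : J | x t = 0})

lemma IsSolutionOn.eqOn (hJ : J.OrdConnected) (hJc : IsClosed J)
    (hA : LocallyIntegrableOn A J) {x y : ℝ → Fin n → ℝ} (hx : IsSolutionOn A J x)
    (hy : IsSolutionOn A J y) {s : ℝ} (hs : s ∈ J) (hxy : x s = y s) : EqOn x y J := by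
  intro t ht
  have h := (hx.add hJ hA (hy.smul (-1))).eq_zero hJ hJc hA hs (by simp [hxy]) t ht
  simpa [← sub_eq_add_neg, sub_eq_zero] using h

/-- The product rule for `exp (c t) f(t)` in integrated form, where `f` is a primitive of an
integrable function; it rests on the fundamental theorem of calculus for absolutely continuous
functions. -/
lemma exp_mul_eq_add_integral {f g : ℝ → ℝ} {a b : ℝ} (hg : IntervalIntegrable g volume a b)
    (hf : ∀ t ∈ uIcc a b, f t = f a + ∫ u in a..t, g u) (c : ℝ) :
    Real.exp (c * b) * f b =
      Real.exp (c * a) * f a + ∫ u in a..b, Real.exp (c * u) * (g u + c * f u) := by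
  set F : ℝ → ℝ := fun t => f a + ∫ u in a..t, g u with hF
  have hFac : AbsolutelyContinuousOnInterval F a b := by
    have h1 : AbsolutelyContinuousOnInterval (fun _ : ℝ => f a) a b :=
      (contDiff_const.contDiffOn (n := 1)).absolutelyContinuousOnInterval
    exact h1.add (hg.absolutelyContinuousOnInterval_intervalIntegral left_mem_uIcc)
  have hEac : AbsolutelyContinuousOnInterval (fun u : ℝ => Real.exp (c * u)) a b :=
    (ContDiff.contDiffOn (n := 1) (by fun_prop)).absolutelyContinuousOnInterval
  have hmain := hEac.integral_deriv_mul_eq_sub hFac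
  have hcongr : ∫ u in a..b, (deriv (fun u : ℝ => Real.exp (c * u)) u * F u
      + Real.exp (c * u) * deriv F u) = ∫ u in a..b, Real.exp (c * u) * (g u + c * f u) := by
    refine intervalIntegral.integral_congr_ae ?_
    filter_upwards [hg.ae_hasDerivAt_integral] with u hu hmem
    have hmem' := uIoc_subset_uIcc hmem
    have h1 : deriv F u = g u := ((hu hmem' a left_mem_uIcc).const_add (f a)).deriv
    have h2 : deriv (fun u : ℝ => Real.exp (c * u)) u = Real.exp (c * u) * c := by
      have := ((hasDerivAt_id u).const_mul c).exp
      simpa using this.deriv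
    rw [h1, h2, hf u hmem']
    ring
  rw [hcongr] at hmain
  rw [hf b right_mem_uIcc, hmain]
  simp [hF]

lemma shift_mulVec (lam : ℝ) (u : ℝ) (v : Fin n → ℝ) :
    shift A lam u *ᵥ v = A u *ᵥ v - lam • v := by
  simp [shift, Matrix.sub_mulVec, Matrix.smul_mulVec]

lemma locallyIntegrableOn_shift (hA : LocallyIntegrableOn A J) (hJc : IsClosed J) (lam : ℝ) :
    LocallyIntegrableOn (shift A lam) J :=
  hA.sub (continuousOn_const.locallyIntegrableOn hJc.measurableSet)

/-- Multiplication by `exp (-λ t)` turns solutions of `ẋ = A(t) x` into solutions of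
`ẋ = [A(t) - λ I] x`. -/
lemma IsSolutionOn.shift (hJ : J.OrdConnected) (hJc : IsClosed J) (hA : LocallyIntegrableOn A J)
    {x : ℝ → Fin n → ℝ} (hx : IsSolutionOn A J x) (lam : ℝ) :
    IsSolutionOn (shift A lam) J (fun t => Real.exp (-lam * t) • x t) := by
  rw [isSolutionOn_iff hJ (locallyIntegrableOn_shift hA hJc lam)]
  have hx' := (isSolutionOn_iff hJ hA).1 hx
  refine ⟨ContinuousOn.smul (f := fun t => Real.exp (-lam * t)) (by fun_prop) hx.1,
    fun s hs t ht i => ?_⟩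
  have h := exp_mul_eq_add_integral (f := fun u => x u i)
    (intervalIntegrable_mulVec_apply hJ hA hx.1 hs ht i)
    (fun u hu => hx'.2 s hs u (hJ.uIcc_subset hs ht hu) i) (-lam)
  simp only [Pi.smul_apply, smul_eq_mul]
  rw [h]
  congr 1
  refine intervalIntegral.integral_congr fun u _ => ?_
  simp only [shift_mulVec, Matrix.mulVec_smul, Pi.sub_apply, Pi.smul_apply, smul_eq_mul]
  ring

end Solutions

/-! ### Fundamental matrices -/

section Fundamental

variable {n : ℕ} {A : ℝ → Matrix (Fin n) (Fin n) ℝ} {J : Set ℝ}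
  {X Y : ℝ → Matrix (Fin n) (Fin n) ℝ}

lemma IsFundamentalMatrix.isUnit (hX : IsFundamentalMatrix A J X) {t : ℝ} (ht : t ∈ J) :
    IsUnit (X t) :=
  Matrix.linearIndependent_cols_iff_isUnit.1 (hX.linearIndependent_col t ht)

lemma IsFundamentalMatrix.isSolutionOn_mulVec (hX : IsFundamentalMatrix A J X)
    (hJ : J.OrdConnected) (hA : LocallyIntegrableOn A J) (v : Fin n → ℝ) :
    IsSolutionOn A J (fun t => X t *ᵥ v) := by
  convert IsSolutionOn.sum hJ hA Finset.univ
    (fun j => (hX.isSolutionOn_col j).smul (v j)) using 2 with t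
  ext i
  simp [Matrix.mulVec, dotProduct, mul_comm]

lemma IsFundamentalMatrix.shift (hX : IsFundamentalMatrix A J X) (hJ : J.OrdConnected)
    (hJc : IsClosed J) (hA : LocallyIntegrableOn A J) (lam : ℝ) :
    IsFundamentalMatrix (shift A lam) J (fun t => Real.exp (-lam * t) • X t) where
  isSolutionOn_col j := (hX.isSolutionOn_col j).shift hJ hJc hA lam
  linearIndependent_col t ht := by
    rw [Matrix.linearIndependent_cols_iff_isUnit, Matrix.isUnit_iff_isUnit_det, Matrix.det_smul]
    exact ((IsUnit.mk0 _ (Real.exp_ne_zero _)).pow _).mul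
      ((Matrix.isUnit_iff_isUnit_det _).1 (hX.isUnit ht))

/-- Two fundamental matrices of the same system differ by a constant invertible right factor. -/
lemma IsFundamentalMatrix.exists_eq_mul (hX : IsFundamentalMatrix A J X)
    (hY : IsFundamentalMatrix A J Y) (hJ : J.OrdConnected) (hJc : IsClosed J)
    (hA : LocallyIntegrableOn A J) (hne : J.Nonempty) :
    ∃ V : Matrix (Fin n) (Fin n) ℝ, IsUnit V ∧ ∀ t ∈ J, Y t = X t * V := by
  obtain ⟨s, hs⟩ := hne
  have hXs : IsUnit (X s).det := (Matrix.isUnit_iff_isUnit_det _).1 (hX.isUnit hs)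
  refine ⟨(X s)⁻¹ * Y s, ?_, fun t ht => ?_⟩
  · exact IsUnit.mul ((Matrix.isUnit_nonsing_inv_iff).2 (hX.isUnit hs)) (hY.isUnit hs)
  · refine Matrix.ext_col fun j => ?_
    have h := (hY.isSolutionOn_col j).eqOn hJ hJc hA
      (hX.isSolutionOn_mulVec hJ hA (((X s)⁻¹ * Y s).col j)) hs ?_ ht
    · exact h
    · change (Y s).col j = (X s * ((X s)⁻¹ * Y s)).col j
      rw [Matrix.mul_nonsing_inv_cancel_left _ _ hXs]

end Fundamental

/-! ### Dichotomies relative to a fixed fundamental matrix -/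

section Relative

variable {n : ℕ} {A : ℝ → Matrix (Fin n) (Fin n) ℝ} {J : Set ℝ}
  {X : ℝ → Matrix (Fin n) (Fin n) ℝ} {P Q : Matrix (Fin n) (Fin n) ℝ} {lam μ ν : ℝ}

/-- `P` is a projection and the transition matrices of `X` split along it with exponential rates
strictly below `lam` on the range of `P` and strictly above `lam` on its kernel. For a fundamental
matrix `X` of `ẋ = A(t) x` this is an exponential dichotomy of `ẋ = [A(t) - lam I] x`, with the
weight `exp (-lam t)` moved to the right-hand side; the matrix `X` does not depend on `lam`, which
makes dichotomies for different `lam` comparable. -/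
def SplitsAt (X : ℝ → Matrix (Fin n) (Fin n) ℝ) (J : Set ℝ) (lam : ℝ)
    (P : Matrix (Fin n) (Fin n) ℝ) : Prop :=
  P * P = P ∧ ∃ K α : ℝ, 0 < K ∧ 0 < α ∧
    (∀ t ∈ J, ∀ s ∈ J, s ≤ t → ‖X t * P * (X s)⁻¹‖ ≤ K * Real.exp ((lam - α) * (t - s))) ∧
    (∀ t ∈ J, ∀ s ∈ J, t ≤ s → ‖X t * (1 - P) * (X s)⁻¹‖ ≤ K * Real.exp ((lam + α) * (t - s)))

lemma inv_smul_of_ne_zero {c : ℝ} (hc : c ≠ 0) {M : Matrix (Fin n) (Fin n) ℝ} (hM : IsUnit M) :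
    (c • M)⁻¹ = c⁻¹ • M⁻¹ := by
  refine Matrix.inv_eq_right_inv ?_
  rw [smul_mul_smul_comm, mul_inv_cancel₀ hc, one_smul,
    Matrix.mul_nonsing_inv _ ((Matrix.isUnit_iff_isUnit_det _).1 hM)]

/-- A dichotomy of the shifted system relative to any fundamental matrix `exp (-lam t) X(t) V` is a
splitting of `X` along the similar projection `V P V⁻¹`. -/
lemma HasExpDichotomyWith.exists_splitsAt (hX : IsFundamentalMatrix A J X) (hJ : J.OrdConnected)
    (hJc : IsClosed J) (hA : LocallyIntegrableOn A J) (hne : J.Nonempty)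
    (h : HasExpDichotomyWith (shift A lam) J P) :
    ∃ Q, SplitsAt X J lam Q ∧ Q.rank = P.rank := by
  obtain ⟨hP, Y, hY, K, α, hK, hα, h1, h2⟩ := h
  obtain ⟨V, hV, hYX⟩ := (hX.shift hJ hJc hA lam).exists_eq_mul hY hJ hJc
    (locallyIntegrableOn_shift hA hJc lam) hne
  have hVd : IsUnit V.det := (Matrix.isUnit_iff_isUnit_det _).1 hV
  have hVd' : IsUnit (V⁻¹).det := Matrix.isUnit_nonsing_inv_det _ hVd
  have key : ∀ R : Matrix (Fin n) (Fin n) ℝ, ∀ t ∈ J, ∀ s ∈ J,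
      ‖X t * (V * R * V⁻¹) * (X s)⁻¹‖ = Real.exp (lam * (t - s)) * ‖Y t * R * (Y s)⁻¹‖ := by
    intro R t ht s hs
    have : X t * (V * R * V⁻¹) * (X s)⁻¹ = Real.exp (lam * (t - s)) • (Y t * R * (Y s)⁻¹) := by
      rw [hYX t ht, hYX s hs, Matrix.mul_inv_rev,
        inv_smul_of_ne_zero (Real.exp_ne_zero _) (hX.isUnit hs), ← Real.exp_neg]
      simp only [smul_mul_assoc, mul_smul_comm, smul_smul, ← Real.exp_add, mul_assoc]
      ring_nf
      simp
    rw [this, norm_smul, Real.norm_eq_abs, Real.abs_exp]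
  refine ⟨V * P * V⁻¹, ⟨?_, K, α, hK, hα, fun t ht s hs hst => ?_, fun t ht s hs hst => ?_⟩, ?_⟩
  · calc V * P * V⁻¹ * (V * P * V⁻¹) = V * P * (V⁻¹ * V) * P * V⁻¹ := by noncomm_ring
      _ = V * (P * P) * V⁻¹ := by rw [Matrix.nonsing_inv_mul _ hVd]; noncomm_ring
      _ = V * P * V⁻¹ := by rw [hP]
  · rw [key P t ht s hs]
    calc _ ≤ Real.exp (lam * (t - s)) * (K * Real.exp (-α * (t - s))) :=
          mul_le_mul_of_nonneg_left (h1 t ht s hs hst) (Real.exp_pos _).le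
      _ = K * Real.exp ((lam - α) * (t - s)) := by
          rw [mul_left_comm, ← Real.exp_add]; ring_nf
  · have h1P : 1 - V * P * V⁻¹ = V * (1 - P) * V⁻¹ := by
      rw [mul_sub, sub_mul, mul_one, Matrix.mul_nonsing_inv _ hVd]
    rw [h1P, key (1 - P) t ht s hs]
    calc _ ≤ Real.exp (lam * (t - s)) * (K * Real.exp (-α * (s - t))) :=
          mul_le_mul_of_nonneg_left (h2 t ht s hs hst) (Real.exp_pos _).le
      _ = K * Real.exp ((lam + α) * (t - s)) := by
          rw [mul_left_comm, ← Real.exp_add]; ring_nf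
  · rw [Matrix.rank_mul_eq_left_of_isUnit_det _ _ hVd',
      Matrix.rank_mul_eq_right_of_isUnit_det _ _ hVd]

lemma SplitsAt.hasExpDichotomyWith (hX : IsFundamentalMatrix A J X) (hJ : J.OrdConnected)
    (hJc : IsClosed J) (hA : LocallyIntegrableOn A J) (h : SplitsAt X J lam P) :
    HasExpDichotomyWith (shift A lam) J P := by
  obtain ⟨hP, K, α, hK, hα, h1, h2⟩ := h
  have key : ∀ R : Matrix (Fin n) (Fin n) ℝ, ∀ t ∈ J, ∀ s ∈ J,
      ‖(Real.exp (-lam * t) • X t) * R * (Real.exp (-lam * s) • X s)⁻¹‖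
        = Real.exp (-lam * (t - s)) * ‖X t * R * (X s)⁻¹‖ := by
    intro R t ht s hs
    rw [inv_smul_of_ne_zero (Real.exp_ne_zero _) (hX.isUnit hs), ← Real.exp_neg, smul_mul_assoc,
      smul_mul_smul_comm, ← Real.exp_add, norm_smul, Real.norm_eq_abs, Real.abs_exp]
    ring_nf
  refine ⟨hP, _, hX.shift hJ hJc hA lam, K, α, hK, hα, fun t ht s hs hst => ?_,
    fun t ht s hs hst => ?_⟩
  · rw [key P t ht s hs]
    calc _ ≤ Real.exp (-lam * (t - s)) * (K * Real.exp ((lam - α) * (t - s))) :=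
          mul_le_mul_of_nonneg_left (h1 t ht s hs hst) (Real.exp_pos _).le
      _ = K * Real.exp (-α * (t - s)) := by
          rw [mul_left_comm, ← Real.exp_add]; ring_nf
  · rw [key (1 - P) t ht s hs]
    calc _ ≤ Real.exp (-lam * (t - s)) * (K * Real.exp ((lam + α) * (t - s))) :=
          mul_le_mul_of_nonneg_left (h2 t ht s hs hst) (Real.exp_pos _).le
      _ = K * Real.exp (-α * (s - t)) := by
          rw [mul_left_comm, ← Real.exp_add]; ring_nf

/-- A splitting persists for nearby `ν`, with the same projection. -/
lemma SplitsAt.of_abs_sub_lt (h : SplitsAt X J lam P) :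
    ∃ ε > 0, ∀ ν, |ν - lam| < ε → SplitsAt X J ν P := by
  obtain ⟨hP, K, α, hK, hα, h1, h2⟩ := h
  refine ⟨α, hα, fun ν hν => ⟨hP, K, α - |ν - lam|, hK, sub_pos.2 hν, fun t ht s hs hst =>
    (h1 t ht s hs hst).trans ?_, fun t ht s hs hst => (h2 t ht s hs hst).trans ?_⟩⟩
  · gcongr ?_ * Real.exp ?_
    exact mul_le_mul_of_nonneg_right (by linarith [neg_abs_le (ν - lam)]) (sub_nonneg.2 hst)
  · gcongr ?_ * Real.exp ?_
    exact mul_le_mul_of_nonpos_right (by linarith [le_abs_self (ν - lam)]) (sub_nonpos.2 hst)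

lemma eq_zero_of_norm_le_mul_exp {M : Matrix (Fin n) (Fin n) ℝ} {C δ : ℝ} (hδ : 0 < δ)
    (h : ∀ t, 0 ≤ t → ‖M‖ ≤ C * Real.exp (-(δ * t))) : M = 0 := by
  have hlim : Filter.Tendsto (fun t : ℝ => C * Real.exp (-(δ * t))) Filter.atTop (nhds (C * 0)) :=
    (Real.tendsto_exp_neg_atTop_nhds_zero.comp
      (Filter.tendsto_id.const_mul_atTop hδ)).const_mul C
  rw [mul_zero] at hlim
  refine norm_le_zero_iff.1 (ge_of_tendsto hlim ?_)
  filter_upwards [Filter.eventually_ge_atTop 0] with t ht using h t ht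

/-- The loop from time `0` to time `t` and back, through `S` and then `R`, bounds `R * S` by a
constant that does not depend on `t`. -/
lemma norm_conj_mul_le {R S : Matrix (Fin n) (Fin n) ℝ} {t : ℝ} (ht : IsUnit (X t))
    (h0 : IsUnit (X 0)) :
    ‖R * S‖ ≤ ‖(X 0)⁻¹‖ * (‖X 0 * R * (X t)⁻¹‖ * ‖X t * S * (X 0)⁻¹‖) * ‖X 0‖ := by
  have h0d := (Matrix.isUnit_iff_isUnit_det _).1 h0
  have htd := (Matrix.isUnit_iff_isUnit_det _).1 ht
  have : R * S = (X 0)⁻¹ * ((X 0 * R * (X t)⁻¹) * (X t * S * (X 0)⁻¹)) * X 0 := by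
    simp only [mul_assoc, Matrix.nonsing_inv_mul_cancel_left _ _ htd,
      Matrix.nonsing_inv_mul_cancel_left _ _ h0d, Matrix.nonsing_inv_mul _ h0d, mul_one]
  calc ‖R * S‖ = ‖(X 0)⁻¹ * ((X 0 * R * (X t)⁻¹) * (X t * S * (X 0)⁻¹)) * X 0‖ := by rw [← this]
    _ ≤ ‖(X 0)⁻¹ * ((X 0 * R * (X t)⁻¹) * (X t * S * (X 0)⁻¹))‖ * ‖X 0‖ := norm_mul_le _ _
    _ ≤ _ := by
      gcongr
      exact (norm_mul_le _ _).trans (by gcongr; exact norm_mul_le _ _)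

/-- Near `+∞` the range of the projection grows with `lam`: a solution of rate below `lam` has no
component of rate above `μ`. -/
lemma SplitsAt.mul_eq_of_Ici_subset (hX : IsFundamentalMatrix A J X) (hJ : Ici 0 ⊆ J)
    (hP : SplitsAt X J lam P) (hQ : SplitsAt X J μ Q) (hle : lam ≤ μ) : Q * P = P := by
  obtain ⟨-, K, α, hK, hα, h1, -⟩ := hP
  obtain ⟨-, L, β, hL, hβ, -, h2⟩ := hQ
  have h0 : (0 : ℝ) ∈ J := hJ self_mem_Ici
  have : (1 - Q) * P = 0 := by
    refine eq_zero_of_norm_le_mul_exp (C := ‖(X 0)⁻¹‖ * (L * K) * ‖X 0‖)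
      (δ := μ + β - (lam - α)) (by linarith) fun t ht => ?_
    refine (norm_conj_mul_le (hX.isUnit (hJ ht)) (hX.isUnit h0)).trans ?_
    calc _ ≤ ‖(X 0)⁻¹‖ * ((L * Real.exp ((μ + β) * (0 - t))) *
          (K * Real.exp ((lam - α) * (t - 0)))) * ‖X 0‖ := by
          gcongr
          · exact h2 0 h0 t (hJ ht) ht
          · exact h1 t (hJ ht) 0 h0 ht
      _ = ‖(X 0)⁻¹‖ * (L * K) * ‖X 0‖ *
          (Real.exp ((μ + β) * (0 - t)) * Real.exp ((lam - α) * (t - 0))) := by ring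
      _ = _ := by rw [← Real.exp_add]; ring_nf
  rw [sub_mul, one_mul, sub_eq_zero] at this
  exact this.symm

/-- Near `-∞` the kernel of the projection shrinks as `lam` grows. -/
lemma SplitsAt.mul_eq_of_Iic_subset (hX : IsFundamentalMatrix A J X) (hJ : Iic 0 ⊆ J)
    (hP : SplitsAt X J lam P) (hQ : SplitsAt X J μ Q) (hle : lam ≤ μ) : P * Q = P := by
  obtain ⟨-, K, α, hK, hα, h1, -⟩ := hP
  obtain ⟨-, L, β, hL, hβ, -, h2⟩ := hQ
  have h0 : (0 : ℝ) ∈ J := hJ self_mem_Iic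
  have : P * (1 - Q) = 0 := by
    refine eq_zero_of_norm_le_mul_exp (C := ‖(X 0)⁻¹‖ * (K * L) * ‖X 0‖)
      (δ := μ + β - (lam - α)) (by linarith) fun t ht => ?_
    have ht' : -t ≤ 0 := neg_nonpos.2 ht
    refine (norm_conj_mul_le (hX.isUnit (hJ ht')) (hX.isUnit h0)).trans ?_
    calc _ ≤ ‖(X 0)⁻¹‖ * ((K * Real.exp ((lam - α) * (0 - -t))) *
          (L * Real.exp ((μ + β) * (-t - 0)))) * ‖X 0‖ := by
          gcongr
          · exact h1 0 h0 (-t) (hJ ht') ht'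
          · exact h2 (-t) (hJ ht') 0 h0 ht'
      _ = ‖(X 0)⁻¹‖ * (K * L) * ‖X 0‖ *
          (Real.exp ((lam - α) * (0 - -t)) * Real.exp ((μ + β) * (-t - 0))) := by ring
      _ = _ := by rw [← Real.exp_add]; ring_nf
  rw [mul_sub, mul_one, sub_eq_zero] at this
  exact this.symm

/-- A projection `P` whose range is contained in that of `Q`, with equal rank, has the same range. -/
lemma mul_eq_right_of_rank_eq (hP : P * P = P) (h : Q * P = P) (hr : P.rank = Q.rank) :
    P * Q = Q := by
  have hle : LinearMap.range P.mulVecLin ≤ LinearMap.range Q.mulVecLin := by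
    rw [← h, Matrix.mulVecLin_mul]
    exact LinearMap.range_comp_le_range _ _
  have heq := Submodule.eq_of_le_of_finrank_eq hle hr
  refine Matrix.ext_of_mulVec_single fun i => ?_
  rw [← Matrix.mulVec_mulVec]
  obtain ⟨w, hw⟩ : Q.mulVecLin (Pi.single i 1) ∈ LinearMap.range P.mulVecLin :=
    heq ▸ LinearMap.mem_range_self _ _
  simp only [Matrix.mulVecLin_apply] at hw
  rw [← hw, Matrix.mulVec_mulVec, hP]

/-- The version of `mul_eq_right_of_rank_eq` for kernels, obtained by transposition. -/
lemma mul_eq_left_of_rank_eq (hP : P * P = P) (h : P * Q = P) (hr : P.rank = Q.rank) :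
    Q * P = Q := by
  have := mul_eq_right_of_rank_eq (P := Pᵀ) (Q := Qᵀ) (by rw [← Matrix.transpose_mul, hP])
    (by rw [← Matrix.transpose_mul, h]) (by rw [Matrix.rank_transpose, Matrix.rank_transpose, hr])
  rw [← Matrix.transpose_mul] at this
  exact Matrix.transpose_injective this

lemma norm_transition_mul_le {R S : Matrix (Fin n) (Fin n) ℝ} {t s : ℝ} (ht : IsUnit (X t)) :
    ‖X t * (R * S) * (X s)⁻¹‖ ≤ ‖X t * R * (X t)⁻¹‖ * ‖X t * S * (X s)⁻¹‖ := by
  have htd := (Matrix.isUnit_iff_isUnit_det _).1 ht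
  have : X t * (R * S) * (X s)⁻¹ = (X t * R * (X t)⁻¹) * (X t * S * (X s)⁻¹) := by
    simp only [mul_assoc, Matrix.nonsing_inv_mul_cancel_left _ _ htd]
  rw [this]
  exact norm_mul_le _ _

/-- If `P` and `Q` have the same range, `P` splits the system at every `ν` between `lam` and `μ`: the
growth above `ν` comes from `1 - P = (1 - P) * (1 - Q)`, where the first factor stays bounded along
`X`. -/
lemma SplitsAt.of_range_eq (hX : IsFundamentalMatrix A J X)
    (hP : SplitsAt X J lam P) (hQ : SplitsAt X J μ Q) (hPQ : P * Q = Q)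
    (h1 : lam ≤ ν) (h2 : ν ≤ μ) : SplitsAt X J ν P := by
  obtain ⟨hPP, K, α, hK, hα, hP1, hP2⟩ := hP
  obtain ⟨-, L, β, hL, hβ, -, hQ2⟩ := hQ
  have hfac : 1 - P = (1 - P) * (1 - Q) := by
    rw [mul_sub, mul_one, sub_mul 1 P Q, one_mul, hPQ, sub_self, sub_zero]
  refine ⟨hPP, max K (K * L), min α β, lt_max_of_lt_left hK, lt_min hα hβ,
    fun t ht s hs hst => (hP1 t ht s hs hst).trans ?_, fun t ht s hs hst => ?_⟩
  · have : (lam - α) * (t - s) ≤ (ν - min α β) * (t - s) :=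
      mul_le_mul_of_nonneg_right (by linarith [min_le_left α β]) (sub_nonneg.2 hst)
    gcongr
    exact le_max_left _ _
  · have : (μ + β) * (t - s) ≤ (ν + min α β) * (t - s) :=
      mul_le_mul_of_nonpos_right (by linarith [min_le_right α β]) (sub_nonpos.2 hst)
    have hd : ‖X t * (1 - P) * (X t)⁻¹‖ ≤ K := by simpa using hP2 t ht t ht le_rfl
    rw [hfac]
    calc _ ≤ _ := norm_transition_mul_le (hX.isUnit ht)
      _ ≤ K * (L * Real.exp ((μ + β) * (t - s))) := by
          gcongr
          exact hQ2 t ht s hs hst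
      _ = K * L * Real.exp ((μ + β) * (t - s)) := by ring
      _ ≤ _ := by
          gcongr
          exact le_max_right _ _

/-- If `P` and `Q` have the same kernel, `Q` splits the system at every `ν` between `lam` and `μ`:
the decay below `ν` comes from `Q = Q * P`, where the first factor stays bounded along `X`. -/
lemma SplitsAt.of_ker_eq (hX : IsFundamentalMatrix A J X)
    (hP : SplitsAt X J lam P) (hQ : SplitsAt X J μ Q) (hQP : Q * P = Q)
    (h1 : lam ≤ ν) (h2 : ν ≤ μ) : SplitsAt X J ν Q := by
  obtain ⟨-, K, α, hK, hα, hP1, -⟩ := hP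
  obtain ⟨hQQ, L, β, hL, hβ, hQ1, hQ2⟩ := hQ
  refine ⟨hQQ, max L (L * K), min α β, lt_max_of_lt_left hL, lt_min hα hβ,
    fun t ht s hs hst => ?_, fun t ht s hs hst => (hQ2 t ht s hs hst).trans ?_⟩
  · have : (lam - α) * (t - s) ≤ (ν - min α β) * (t - s) :=
      mul_le_mul_of_nonneg_right (by linarith [min_le_left α β]) (sub_nonneg.2 hst)
    have hd : ‖X t * Q * (X t)⁻¹‖ ≤ L := by simpa using hQ1 t ht t ht le_rfl
    rw [← hQP]
    calc _ ≤ _ := norm_transition_mul_le (hX.isUnit ht)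
      _ ≤ L * (K * Real.exp ((lam - α) * (t - s))) := by
          gcongr
          exact hP1 t ht s hs hst
      _ = L * K * Real.exp ((lam - α) * (t - s)) := by ring
      _ ≤ _ := by
          gcongr
          exact le_max_right _ _
  · have : (μ + β) * (t - s) ≤ (ν + min α β) * (t - s) :=
      mul_le_mul_of_nonpos_right (by linarith [min_le_right α β]) (sub_nonpos.2 hst)
    gcongr
    exact le_max_left _ _

lemma SplitsAt.rank_le (hX : IsFundamentalMatrix A J X) (hJ : Ici 0 ⊆ J ∨ Iic 0 ⊆ J)
    (hP : SplitsAt X J lam P) (hQ : SplitsAt X J μ Q) (hle : lam ≤ μ) : P.rank ≤ Q.rank := by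
  rcases hJ with hJ | hJ
  · rw [← SplitsAt.mul_eq_of_Ici_subset hX hJ hP hQ hle]
    exact Matrix.rank_mul_le_left _ _
  · rw [← SplitsAt.mul_eq_of_Iic_subset hX hJ hP hQ hle]
    exact Matrix.rank_mul_le_right _ _

lemma SplitsAt.exists_between (hX : IsFundamentalMatrix A J X) (hJ : Ici 0 ⊆ J ∨ Iic 0 ⊆ J)
    (hP : SplitsAt X J lam P) (hQ : SplitsAt X J μ Q) (hr : P.rank = Q.rank)
    (h1 : lam ≤ ν) (h2 : ν ≤ μ) : ∃ R, SplitsAt X J ν R ∧ R.rank = P.rank := by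
  rcases hJ with hJ | hJ
  · have h := SplitsAt.mul_eq_of_Ici_subset hX hJ hP hQ (h1.trans h2)
    exact ⟨P, hP.of_range_eq hX hQ (mul_eq_right_of_rank_eq hP.1 h hr) h1 h2, rfl⟩
  · have h := SplitsAt.mul_eq_of_Iic_subset hX hJ hP hQ (h1.trans h2)
    exact ⟨Q, hP.of_ker_eq hX hQ (mul_eq_left_of_rank_eq hP.1 h hr) h1 h2, hr.symm⟩

lemma splitsAt_one {K α : ℝ} (hK : 0 < K)
    (h : ∀ t ∈ J, ∀ s ∈ J, ‖transitionMatrix X t s‖ ≤ K * Real.exp (α * |t - s|))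
    (hlam : α < lam) : SplitsAt X J lam 1 := by
  refine ⟨one_mul 1, K, lam - α, hK, sub_pos.2 hlam, fun t ht s hs hst => ?_,
    fun t ht s hs hst => by simp; positivity⟩
  simpa [transitionMatrix, abs_of_nonneg (sub_nonneg.2 hst)] using h t ht s hs

lemma splitsAt_zero {K α : ℝ} (hK : 0 < K)
    (h : ∀ t ∈ J, ∀ s ∈ J, ‖transitionMatrix X t s‖ ≤ K * Real.exp (α * |t - s|))
    (hlam : lam < -α) : SplitsAt X J lam 0 := by
  refine ⟨mul_zero 0, K, -α - lam, hK, sub_pos.2 hlam, fun t ht s hs hst => by simp; positivity,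
    fun t ht s hs hst => ?_⟩
  have he : (lam + (-α - lam)) * (t - s) = α * |t - s| := by
    rw [abs_of_nonpos (sub_nonpos.2 hst)]
    ring
  rw [he]
  simpa [transitionMatrix] using h t ht s hs

end Relative

/-! ### Ordered families of open intervals -/

section Intervals

/-- Discarding the empty members of a family of open intervals of `ℝ` indexed by `0, …, n`, placed
from left to right, leaves a strictly ordered family of open intervals. -/
lemma exists_strict_family {n : ℕ} (hn : 1 ≤ n) {G : ℕ → Set ℝ} (hopen : ∀ k, IsOpen (G k))
    (hconn : ∀ k, (G k).OrdConnected)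
    (hmono : ∀ j k, ∀ x ∈ G j, ∀ y ∈ G k, x ≤ y → j ≤ k)
    (hle : ∀ k, (G k).Nonempty → k ≤ n) (h0 : (G 0).Nonempty) (hlast : (G n).Nonempty) :
    ∃ ℓ : ℕ, 1 ≤ ℓ ∧ ℓ ≤ n ∧ ∃ U : Fin (ℓ + 1) → Set ℝ, (∀ i, IsOpen (U i)) ∧
      (∀ i, (U i).OrdConnected) ∧ (∀ i, (U i).Nonempty) ∧
      (∀ i j, i < j → ∀ x ∈ U i, ∀ y ∈ U j, x < y) ∧ U 0 = G 0 ∧ U (Fin.last ℓ) = G n ∧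
      ⋃ k, G k = ⋃ i, U i := by
  classical
  set H : Finset ℕ := (Finset.range (n + 1)).filter fun k => (G k).Nonempty with hH
  have hmem : ∀ k, k ∈ H ↔ (G k).Nonempty := fun k => by
    simp only [hH, Finset.mem_filter, Finset.mem_range, Nat.lt_succ_iff, and_iff_right_iff_imp]
    exact hle k
  have hcard : H.card ≤ n + 1 := (Finset.card_filter_le _ _).trans (by simp)
  have hcard2 : 1 < H.card :=
    Finset.one_lt_card.2 ⟨0, (hmem 0).2 h0, n, (hmem n).2 hlast, by omega⟩
  obtain ⟨ℓ, hℓ⟩ : ∃ ℓ, H.card = ℓ + 1 := ⟨H.card - 1, by omega⟩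
  let e := H.orderEmbOfFin hℓ
  have hrange : ∀ k, (G k).Nonempty → ∃ i, e i = k := fun k hk => by
    have : k ∈ Set.range e := by
      rw [Finset.range_orderEmbOfFin]; exact (hmem k).2 hk
    exact this
  have hne : ∀ i, (G (e i)).Nonempty := fun i => (hmem _).1 (Finset.orderEmbOfFin_mem H hℓ i)
  refine ⟨ℓ, by omega, by omega, fun i => G (e i), fun i => hopen _, fun i => hconn _, hne,
    fun i j hij x hx y hy => ?_, ?_, ?_, ?_⟩
  · by_contra! hxy
    exact absurd (hmono _ _ y hy x hx hxy) (not_le.2 (e.strictMono hij))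
  · obtain ⟨i, hi⟩ := hrange 0 h0
    have : e 0 ≤ e i := e.monotone (Fin.zero_le i)
    have h00 : e 0 = 0 := by omega
    simp only [h00]
  · obtain ⟨i, hi⟩ := hrange n hlast
    have h1 : e i ≤ e (Fin.last ℓ) := e.monotone (Fin.le_last i)
    have h2 := hle _ (hne (Fin.last ℓ))
    have h3 : e (Fin.last ℓ) = n := by omega
    simp only [h3]
  · refine Subset.antisymm (iUnion_subset fun k x hx => ?_)
      (iUnion_subset fun i => subset_iUnion G (e i))
    obtain ⟨i, rfl⟩ := hrange k ⟨x, hx⟩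
    exact mem_iUnion.2 ⟨i, hx⟩

/-- The complement of `ℓ + 1` strictly ordered open intervals, the outer two of which are unbounded,
consists of the `ℓ` compact intervals between neighbours. -/
lemma compl_iUnion_eq_iUnion_Icc {ℓ : ℕ} {U : Fin (ℓ + 1) → Set ℝ} (hopen : ∀ i, IsOpen (U i))
    (hconn : ∀ i, (U i).OrdConnected) (hne : ∀ i, (U i).Nonempty)
    (hlt : ∀ i j, i < j → ∀ x ∈ U i, ∀ y ∈ U j, x < y)
    (hbot : ∀ x, ∃ y ∈ U 0, y < x) (htop : ∀ x, ∃ y ∈ U (Fin.last ℓ), x < y) :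
    ∃ a b : Fin ℓ → ℝ, (∀ i, a i ≤ b i) ∧ (∀ i j, i < j → b i < a j) ∧
      (⋃ i, U i)ᶜ = ⋃ i, Icc (a i) (b i) := by
  have hbdA : ∀ i : Fin ℓ, BddAbove (U i.castSucc) := fun i => by
    obtain ⟨y, hy⟩ := hne i.succ
    exact ⟨y, fun x hx => (hlt _ _ i.castSucc_lt_succ x hx y hy).le⟩
  have hbdB : ∀ i : Fin ℓ, BddBelow (U i.succ) := fun i => by
    obtain ⟨x, hx⟩ := hne i.castSucc
    exact ⟨x, fun y hy => (hlt _ _ i.castSucc_lt_succ x hx y hy).le⟩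
  have hgt : ∀ i, ∀ x ∈ U i, ∃ y ∈ U i, x < y := fun i x hx =>
    ((Filter.Eventually.and (mem_nhdsWithin_of_mem_nhds ((hopen i).mem_nhds hx))
      self_mem_nhdsWithin : ∀ᶠ y in nhdsWithin x (Ioi x), y ∈ U i ∧ y ∈ Ioi x)).exists
  have hsm : ∀ i, ∀ x ∈ U i, ∃ y ∈ U i, y < x := fun i x hx =>
    ((Filter.Eventually.and (mem_nhdsWithin_of_mem_nhds ((hopen i).mem_nhds hx))
      self_mem_nhdsWithin : ∀ᶠ y in nhdsWithin x (Iio x), y ∈ U i ∧ y ∈ Iio x)).exists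
  -- A gap to the left of the `i`-th hole lies to the left of `sSup (U i.castSucc)`, and dually.
  have hleft : ∀ (i : Fin ℓ) (k : Fin (ℓ + 1)), k ≤ i.castSucc → ∀ x ∈ U k,
      x < sSup (U i.castSucc) := by
    intro i k hk x hx
    rcases hk.eq_or_lt with rfl | hk
    · obtain ⟨y, hy, hxy⟩ := hgt _ x hx
      exact hxy.trans_le (le_csSup (hbdA i) hy)
    · obtain ⟨y, hy⟩ := hne i.castSucc
      exact (hlt _ _ hk x hx y hy).trans_le (le_csSup (hbdA i) hy)
  have hright : ∀ (i : Fin ℓ) (k : Fin (ℓ + 1)), i.succ ≤ k → ∀ x ∈ U k,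
      sInf (U i.succ) < x := by
    intro i k hk x hx
    rcases hk.eq_or_lt with rfl | hk
    · obtain ⟨y, hy, hxy⟩ := hsm _ x hx
      exact (csInf_le (hbdB i) hy).trans_lt hxy
    · obtain ⟨y, hy⟩ := hne i.succ
      exact (csInf_le (hbdB i) hy).trans_lt (hlt _ _ hk y hy x hx)
  refine ⟨fun i => sSup (U i.castSucc), fun i => sInf (U i.succ), fun i => ?_, fun i j hij => ?_,
    Subset.antisymm (fun x hx => ?_) (fun x hx => ?_)⟩
  · exact csSup_le (hne _) fun x hx => le_csInf (hne _) fun y hy =>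
      (hlt _ _ i.castSucc_lt_succ x hx y hy).le
  · obtain ⟨z, hz⟩ := hne j.castSucc
    exact (hright i _ (Fin.succ_le_castSucc_iff.2 hij) z hz).trans (hleft j _ le_rfl z hz)
  · classical
    have hx' : ∀ i, x ∉ U i := fun i hi => hx (mem_iUnion.2 ⟨i, hi⟩)
    -- `x` lies just to the right of the last gap that has a point left of `x`.
    obtain ⟨i, hi, hmax⟩ := Finset.exists_max_image
      (Finset.univ.filter fun i => ∃ y ∈ U i, y < x) id ⟨0, by simpa using hbot x⟩
    simp only [Finset.mem_filter, Finset.mem_univ, true_and, id] at hi hmax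
    obtain ⟨y, hy, hyx⟩ := hi
    have hup : ∀ z ∈ U i, z ≤ x := fun z hz => by
      by_contra! hxz
      exact hx' i ((hconn i).out hy hz ⟨hyx.le, hxz.le⟩)
    induction i using Fin.lastCases with
    | last =>
      obtain ⟨z, hz, hxz⟩ := htop x
      exact absurd (hup z hz) (not_le.2 hxz)
    | cast j =>
      refine mem_iUnion.2 ⟨j, csSup_le (hne _) hup, le_csInf (hne _) fun z hz => ?_⟩
      by_contra! hzx
      exact absurd (hmax j.succ ⟨z, hz, hzx⟩) (not_le.2 j.castSucc_lt_succ)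
  · obtain ⟨i, hi⟩ := mem_iUnion.1 hx
    intro hxU
    obtain ⟨k, hk⟩ := mem_iUnion.1 hxU
    rcases le_or_gt k i.castSucc with h | h
    · exact absurd hi.1 (not_le.2 (hleft i k h x hk))
    · exact absurd hi.2 (not_le.2 (hright i k (Fin.castSucc_lt_iff_succ_le.1 h) x hk))

/-- The components of a union of disjoint open intervals are these intervals. -/
lemma mem_connectedComponentIn_iUnion_iff {G : ℕ → Set ℝ} (hopen : ∀ k, IsOpen (G k))
    (hconn : ∀ k, (G k).OrdConnected) (hdisj : ∀ j k, j ≠ k → Disjoint (G j) (G k))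
    {j k : ℕ} {x y : ℝ} (hx : x ∈ G j) (hy : y ∈ G k) :
    y ∈ connectedComponentIn (⋃ k, G k) x ↔ j = k := by
  constructor
  · intro h
    have hsub : connectedComponentIn (⋃ k, G k) x ⊆ G j := by
      refine isPreconnected_connectedComponentIn.subset_left_of_subset_union (hopen j)
        (isOpen_biUnion fun i (_ : i ∈ {i | i ≠ j}) => hopen i) ?_ ?_
        ⟨x, mem_connectedComponentIn (mem_iUnion.2 ⟨j, hx⟩), hx⟩
      · exact disjoint_iUnion₂_right.2 fun i hi => hdisj j i (Ne.symm hi)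
      · refine (connectedComponentIn_subset _ _).trans (iUnion_subset fun i => ?_)
        rcases eq_or_ne i j with rfl | hij
        · exact subset_union_left
        · exact (subset_biUnion_of_mem (u := G) (show i ∈ {i | i ≠ j} from hij)).trans
            subset_union_right
    by_contra hjk
    exact disjoint_left.1 (hdisj j k hjk) (hsub h) hy
  · rintro rfl
    exact (hconn j).isPreconnected.subset_connectedComponentIn hx (subset_iUnion G j) hy

end Intervals

end DichotomySpectrum

/-! ### The structure of the spectrum -/

theorem theorem5 {n : ℕ} (hn : 1 ≤ n) (J : Set ℝ)
    (hJ : J = Set.univ ∨ J = Set.Iic 0 ∨ J = Set.Ici 0)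
    (A : ℝ → Matrix (Fin n) (Fin n) ℝ)
    (hA : MeasureTheory.LocallyIntegrableOn A J)
    (hbgd : DichotomySpectrum.HasBoundedGrowthDecay A J) :
    (∃ ℓ : ℕ, 1 ≤ ℓ ∧ ℓ ≤ n ∧ ∃ a b : Fin ℓ → ℝ,
      (∀ i, a i ≤ b i) ∧ (∀ i j, i < j → b i < a j) ∧
      DichotomySpectrum.dichotomySpectrum A J = ⋃ i, Set.Icc (a i) (b i)) ∧
    (∃ m : ℕ, m ≤ n + 1 ∧ ∃ U : Fin m → Set ℝ,
      (∀ i, IsOpen (U i) ∧ (U i).OrdConnected ∧ (U i).Nonempty) ∧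
      (∀ i j, i ≠ j → Disjoint (U i) (U j)) ∧
      DichotomySpectrum.dichotomyResolvent A J = ⋃ i, U i) ∧
    (∀ (lam μ : ℝ) (P Q : Matrix (Fin n) (Fin n) ℝ),
      DichotomySpectrum.HasExpDichotomyWith (DichotomySpectrum.shift A lam) J P →
      DichotomySpectrum.HasExpDichotomyWith (DichotomySpectrum.shift A μ) J Q →
      (lam ≤ μ → P.rank ≤ Q.rank) ∧
      (μ ∈ DichotomySpectrum.spectralGap A J lam ↔ P.rank = Q.rank)) := by
  open DichotomySpectrum in
  have hJo : J.OrdConnected := by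
    rcases hJ with rfl | rfl | rfl
    exacts [ordConnected_univ, ordConnected_Iic, ordConnected_Ici]
  have hJc : IsClosed J := by
    rcases hJ with rfl | rfl | rfl
    exacts [isClosed_univ, isClosed_Iic, isClosed_Ici]
  have hJh : Ici 0 ⊆ J ∨ Iic 0 ⊆ J := by
    rcases hJ with rfl | rfl | rfl
    exacts [Or.inl (subset_univ _), Or.inr Subset.rfl, Or.inl Subset.rfl]
  have hJn : J.Nonempty := by
    rcases hJ with rfl | rfl | rfl
    exacts [univ_nonempty, nonempty_Iic, nonempty_Ici]
  obtain ⟨X, hX, K, α, hK, -, hgrowth⟩ := hbgd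
  -- The part of the resolvent where the projections have rank `k`.
  set G : ℕ → Set ℝ := fun k => {lam | ∃ P, SplitsAt X J lam P ∧ P.rank = k} with hG
  have hres : dichotomyResolvent A J = ⋃ k, G k := by
    ext lam
    simp only [dichotomyResolvent, dichotomySpectrum, mem_compl_iff, mem_ofPred_eq, not_not,
      mem_iUnion, hG]
    constructor
    · rintro ⟨P, hP⟩
      obtain ⟨Q, hQ, -⟩ := hP.exists_splitsAt hX hJo hJc hA hJn
      exact ⟨Q.rank, Q, hQ, rfl⟩
    · rintro ⟨-, P, hP, -⟩
      exact ⟨P, hP.hasExpDichotomyWith hX hJo hJc hA⟩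
  have hopen : ∀ k, IsOpen (G k) := by
    refine fun k => Metric.isOpen_iff.2 fun lam ⟨P, hP, hk⟩ => ?_
    obtain ⟨ε, hε, h⟩ := hP.of_abs_sub_lt
    exact ⟨ε, hε, fun ν hν => ⟨P, h ν hν, hk⟩⟩
  have hmono : ∀ j k, ∀ x ∈ G j, ∀ y ∈ G k, x ≤ y → j ≤ k := by
    rintro j k x ⟨P, hP, rfl⟩ y ⟨Q, hQ, rfl⟩ hxy
    exact hP.rank_le hX hJh hQ hxy
  have hconn : ∀ k, (G k).OrdConnected := by
    refine fun k => ⟨?_⟩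
    rintro x ⟨P, hP, hPk⟩ y ⟨Q, hQ, hQk⟩ ν ⟨hxν, hνy⟩
    obtain ⟨R, hR, hRP⟩ := hP.exists_between hX hJh hQ (hPk.trans hQk.symm) hxν hνy
    exact ⟨R, hR, hRP.trans hPk⟩
  have hdisj : ∀ j k, j ≠ k → Disjoint (G j) (G k) := fun j k hjk =>
    disjoint_left.2 fun x hj hk =>
      hjk (le_antisymm (hmono j k x hj x hk le_rfl) (hmono k j x hk x hj le_rfl))
  have hle : ∀ k, (G k).Nonempty → k ≤ n := by
    rintro k ⟨x, P, -, rfl⟩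
    exact P.rank_le_width
  have hbot : ∀ x < -α, x ∈ G 0 := fun x hx =>
    ⟨0, splitsAt_zero hK hgrowth hx, Matrix.rank_zero⟩
  have htop : ∀ x, α < x → x ∈ G n := fun x hx =>
    ⟨1, splitsAt_one hK hgrowth hx, by rw [Matrix.rank_one, Fintype.card_fin]⟩
  obtain ⟨ℓ, h1ℓ, hℓn, U, hUo, hUc, hUn, hUlt, hU0, hUlast, hGU⟩ :=
    exists_strict_family hn hopen hconn hmono hle ⟨-α - 1, hbot _ (by linarith)⟩
      ⟨α + 1, htop _ (by linarith)⟩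
  refine ⟨⟨ℓ, h1ℓ, hℓn, ?_⟩, ⟨ℓ + 1, by omega, U, fun i => ⟨hUo i, hUc i, hUn i⟩,
    fun i j hij => ?_, hres.trans hGU⟩, fun lam μ P Q hP hQ => ?_⟩
  · have hspec : dichotomySpectrum A J = (⋃ i, U i)ᶜ := by
      rw [← hGU, ← hres, dichotomyResolvent, compl_compl]
    rw [hspec]
    refine compl_iUnion_eq_iUnion_Icc hUo hUc hUn hUlt (fun x => ?_) fun x => ?_
    · refine ⟨min x (-α) - 1, hU0 ▸ hbot _ ?_, ?_⟩
      · linarith [min_le_left x (-α)]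
      · linarith [min_le_right x (-α)]
    · refine ⟨max x α + 1, hUlast ▸ htop _ ?_, ?_⟩
      · linarith [le_max_left x α]
      · linarith [le_max_right x α]
  · refine disjoint_left.2 fun x hxi hxj => ?_
    rcases lt_or_gt_of_ne hij with h | h
    · exact lt_irrefl x (hUlt i j h x hxi x hxj)
    · exact lt_irrefl x (hUlt j i h x hxj x hxi)
  · obtain ⟨P', hP', hPr⟩ := hP.exists_splitsAt hX hJo hJc hA hJn
    obtain ⟨Q', hQ', hQr⟩ := hQ.exists_splitsAt hX hJo hJc hA hJn
    rw [← hPr, ← hQr]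
    refine ⟨fun h => hP'.rank_le hX hJh hQ' h, ?_⟩
    rw [spectralGap, hres]
    exact mem_connectedComponentIn_iUnion_iff hopen hconn hdisj ⟨P', hP', rfl⟩ ⟨Q', hQ', rfl⟩
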